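/- Let $\mathbb{R}^+=[0,\infty)$ and consider the equation $$Q(B(x))=\int_0^\infty \bigl(K(x-t)-K(x+t)\bigr)\bigl(B(t)+\omega_2(t,B(t))\bigr)\,dt,\qquad x\in\mathbb{R}^+. \tag{1}$$ Assume the following. Kernel: $K:\mathbb{R}\to(0,\infty)$ is even, continuously differentiable, bounded with bounded derivative, monotonically decreasing (not necessarily strictly) on $\mathbb{R}^+$, with $\int_0^\infty K(t)\,dt=\tfrac12$ and $\int_0^\infty xK(x)\,dx<\infty$. Perturbation: $\omega_2$ is continuous on $\mathbb{R}^+\times\mathbb{R}^+$, $\omega_2(t,0)=0$, and for every $t\in\mathbb{R}^+$ the function $u\mapsto\omega_2(t,u)$ is non-decreasing and concave on $\mathbb{R}^+$. There is a positive integrable function $\mu_2$ on $\mathbb{R}^+$ with $\mu_2(t)\to0$ as $t\to\infty$ and $\omega_2(t,u)\le\mu_2(t)u$ for all $t,u\in\mathbb{R}^+$. Put $M=\int_0^\infty\mu_2(t)\,dt\cdot\sup_{x\in\mathbb{R}}K(x)$. Nonlinearity: $Q$ is continuous, strictly increasing and convex on $\mathbb{R}^+$, $Q(0)=0$, and there is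 $\xi>0$ with $Q(\xi)=(1+M)\xi$. Let $G$ be the inverse function of $Q$ on $\mathbb{R}^+$. There is a continuous, monotonically increasing (not necessarily strictly), concave map $\varphi:[0,1]\to[0,1]$, different from the identity, with $\varphi(0)=0$, $\varphi(1)=1$ and $$G(\sigma u)\ge\varphi(\sigma)G(u),\qquad \sigma\in(0,1),\ u\in(0,(1+M)\xi).$$ Then equation (1) has exactly one solution in the class $\mathfrak{M}$ of bounded non-negative functions $B$ on $\mathbb{R}^+$ for which $\inf_{x>r}B(x)>0$ for some $r>0$, and this solution is continuous on $\mathbb{R}^+$. Uniqueness holds among all solutions in $\mathfrak{M}$, with no continuity assumed. -/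

import Mathlib

open Set Filter Topology MeasureTheory

noncomputable section

/-- The sum-difference kernel `K (x - t) - K (x + t)`. -/
def sumDiffKernel (K : ℝ → ℝ) (x t : ℝ) : ℝ := K (x - t) - K (x + t)

/-- `B` solves `Q (B x) = ∫₀^∞ (K (x - t) - K (x + t)) (B t + ω₂ (t, B t)) dt` for all `x ≥ 0`;
the integral is required to exist. Only the values of `B` on `[0, ∞)` matter. -/
def IsSolution (K : ℝ → ℝ) (ω₂ : ℝ → ℝ → ℝ) (Q B : ℝ → ℝ) : Prop :=
  ∀ x : ℝ, 0 ≤ x →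
    IntegrableOn (fun t => sumDiffKernel K x t * (B t + ω₂ t (B t))) (Ioi 0) ∧
    Q (B x) = ∫ t in Ioi (0 : ℝ), sumDiffKernel K x t * (B t + ω₂ t (B t))

/-- The class of bounded non-negative functions on `[0, ∞)` with positive infimum on some
`(r, ∞)`, `r > 0`. -/
def InClassM (B : ℝ → ℝ) : Prop :=
  (∃ C : ℝ, ∀ x : ℝ, 0 ≤ x → |B x| ≤ C) ∧
  (∀ x : ℝ, 0 ≤ x → 0 ≤ B x) ∧
  ∃ r : ℝ, 0 < r ∧ 0 < sInf (B '' Ioi r)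

/-- The number `M = ∫₀^∞ μ₂(t) dt · sup K`. -/
def constM (K μ₂ : ℝ → ℝ) : ℝ := (∫ t in Ioi (0 : ℝ), μ₂ t) * ⨆ x : ℝ, K x

/-- The inverse function of `Q` on `[0, ∞)` (used where `Q` maps `[0, ∞)` bijectively onto
itself). -/
def halfLineInverse (Q : ℝ → ℝ) : ℝ → ℝ := Function.invFunOn Q (Ici 0)

end

/-! The right-hand side of (1) preserves order, since the kernel and `u ↦ u + ω₂ t u` are monotone
in the relevant sense, and it is sublinear, since `ω₂ t` is concave with value `0` at `0`. Strict
sublinearity comes from `Q`: because `φ σ > σ`, an inequality `σ * Q (B x) ≤ Q (B' x)` improves to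
the same inequality with `φ σ`.

Uniqueness: a solution in the class lies below `ξ` (`IsSolution.lt_xi`), where the scaling of `Q` is
available, and any two solutions are comparable up to a factor (`IsSolution.exists_mul_le`), since
both images under `Q` are of order `min x r`. The greatest admissible factor cannot be less than
`1`, by the improvement above (`IsSolution.le`). Only integrability of the integrand is used, not
regularity of the solutions.

Existence: the constant `ξ` is a supersolution and a small multiple of the indicator of `(1, ∞)` is
a subsolution. Iterating downwards from `ξ` converges to a trapped fixed point; the integral
operator makes it continuous. -/

/-! ### The kernel and its integrals. -/

/-- The properties of the kernel used for the sum-difference equation; `L` is a Lipschitz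
constant. -/
structure EvenDecreasingKernel (K : ℝ → ℝ) (L : ℝ) : Prop where
  pos : ∀ x, 0 < K x
  even : ∀ x, K (-x) = K x
  cont : Continuous K
  anti : AntitoneOn K (Ici 0)
  integrableOn : IntegrableOn K (Ioi 0)
  half : ∫ t in Ioi (0 : ℝ), K t = 1 / 2
  lip : ∀ x y, |K x - K y| ≤ L * |x - y|

namespace EvenDecreasingKernel

variable {K : ℝ → ℝ} {L : ℝ} (h : EvenDecreasingKernel K L)
include h

lemma apply_abs (x : ℝ) : K |x| = K x := by
  rcases abs_choice x with hx | hx <;> rw [hx]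
  exact h.even x

lemma le_of_abs_le {x y : ℝ} (hxy : |x| ≤ |y|) : K y ≤ K x := by
  rw [← h.apply_abs x, ← h.apply_abs y]
  exact h.anti (abs_nonneg x) (abs_nonneg y) hxy

lemma le_zero (x : ℝ) : K x ≤ K 0 := h.le_of_abs_le (by simp)

lemma iSup_eq : ⨆ x, K x = K 0 :=
  le_antisymm (ciSup_le h.le_zero) (le_ciSup ⟨K 0, by rintro _ ⟨x, rfl⟩; exact h.le_zero x⟩ 0)

lemma lip_nonneg : 0 ≤ L := by
  have := (abs_nonneg _).trans (h.lip 1 0)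
  simpa using this

lemma integrable : Integrable K := by
  have h1 : IntegrableOn K (Iio 0) := by
    have := ((Measure.measurePreserving_neg (volume : Measure ℝ)).integrableOn_comp_preimage
      (MeasurableEquiv.neg ℝ).measurableEmbedding (f := K) (s := Ioi 0)).2 h.integrableOn
    have e : K ∘ Neg.neg = K := funext h.even
    rw [e] at this
    simpa using this
  have h2 : IntegrableOn K (Iic 0) := (integrableOn_Iic_iff_integrableOn_Iio).2 h1
  have := h2.union h.integrableOn
  rwa [Iic_union_Ioi, integrableOn_univ] at this

lemma integral_eq_one : ∫ t, K t = 1 := by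
  have := integral_comp_abs (f := K)
  simp only [h.apply_abs, h.half] at this
  rw [this]; norm_num

lemma sumDiff_nonneg {x t : ℝ} (hx : 0 ≤ x) (ht : 0 ≤ t) : 0 ≤ sumDiffKernel K x t := by
  refine sub_nonneg.2 (h.le_of_abs_le ?_)
  rw [abs_of_nonneg (add_nonneg hx ht)]
  exact abs_le.2 ⟨by linarith, by linarith⟩

lemma abs_sumDiff_le (x t : ℝ) : |sumDiffKernel K x t| ≤ K 0 := by
  unfold sumDiffKernel
  have h1 := h.le_zero (x - t)
  have h2 := h.le_zero (x + t)
  have h3 := h.pos (x - t)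
  have h4 := h.pos (x + t)
  exact abs_le.2 ⟨by linarith, by linarith⟩

/-- The arguments `t - x` and `t + x` differ by `2 * x`, so the Lipschitz bound gives linear decay
at `x = 0`, uniformly in `t`. -/
lemma sumDiff_le_linear {x : ℝ} (hx : 0 ≤ x) (t : ℝ) : sumDiffKernel K x t ≤ 2 * L * x := by
  unfold sumDiffKernel
  have h1 := (le_abs_self _).trans (h.lip (t - x) (x + t))
  rw [← h.even (t - x), neg_sub, show t - x - (x + t) = -(2 * x) by ring, abs_neg,
    abs_of_nonneg (by positivity)] at h1
  linarith

lemma continuous_sumDiff : Continuous fun p : ℝ × ℝ => sumDiffKernel K p.1 p.2 := by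
  have := h.cont
  unfold sumDiffKernel
  fun_prop

lemma integrable_comp_sub (x : ℝ) : Integrable fun t => K (x - t) :=
  h.integrable.comp_sub_left x

lemma integrable_comp_add (x : ℝ) : Integrable fun t => K (x + t) :=
  h.integrable.comp_add_left x

lemma integrable_sumDiff (x : ℝ) : Integrable (sumDiffKernel K x) :=
  (h.integrable_comp_sub x).sub (h.integrable_comp_add x)

lemma setIntegral_sumDiff_eq_sub (x r : ℝ) :
    ∫ t in Ioi r, sumDiffKernel K x t = (∫ s in Ioi (r - x), K s) - ∫ s in Ioi (r + x), K s := by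
  unfold sumDiffKernel
  rw [integral_sub (h.integrable_comp_sub x).integrableOn (h.integrable_comp_add x).integrableOn]
  congr 1
  · have := (measurePreserving_sub_right (volume : Measure ℝ) x).setIntegral_preimage_emb
      (MeasurableEquiv.subRight x).measurableEmbedding K (Ioi (r - x))
    rw [← this]
    simp only [preimage_sub_const_Ioi, sub_add_cancel]
    refine integral_congr_ae (ae_of_all _ fun t => ?_)
    simp only
    rw [← h.even (t - x), neg_sub]
  · have := (measurePreserving_add_right (volume : Measure ℝ) x).setIntegral_preimage_emb
      (MeasurableEquiv.addRight x).measurableEmbedding K (Ioi (r + x))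
    rw [← this]
    rw [preimage_add_const_Ioi, add_sub_cancel_right]
    simp only [add_comm x]

lemma setIntegral_sumDiff_eq (x r : ℝ) :
    ∫ t in Ioi r, sumDiffKernel K x t = ∫ s in (r - x)..(r + x), K s := by
  rw [h.setIntegral_sumDiff_eq_sub, intervalIntegral.integral_Ioi_sub_Ioi'
    h.integrable.integrableOn h.integrable.integrableOn]

/-- The deficit is at least the tail of `K` beyond `x`, which is positive. This strictness keeps
solutions strictly below `ξ`. -/
lemma integral_sumDiff_lt_one (x : ℝ) : ∫ t in Ioi 0, sumDiffKernel K x t < 1 := by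
  rw [h.setIntegral_sumDiff_eq_sub]
  have h1 : ∫ s in Ioi (0 - x), K s ≤ 1 := by
    rw [← h.integral_eq_one]
    exact setIntegral_le_integral h.integrable (ae_of_all _ fun t => (h.pos t).le)
  have h2 : 0 < ∫ s in Ioi (0 + x), K s := by
    rw [setIntegral_pos_iff_support_of_nonneg_ae (ae_of_all _ fun t => (h.pos t).le)
      h.integrable.integrableOn]
    have : Function.support K = univ := eq_univ_of_forall fun t => (h.pos t).ne'
    simp [this]
  linarith

lemma integral_sumDiff_le_linear {x : ℝ} (hx : 0 ≤ x) :
    ∫ t in Ioi 0, sumDiffKernel K x t ≤ 2 * K 0 * x := by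
  rw [h.setIntegral_sumDiff_eq]
  have := intervalIntegral.integral_mono_on (μ := volume) (a := 0 - x) (b := 0 + x) (by linarith)
    (h.cont.intervalIntegrable _ _) (intervalIntegrable_const (c := K 0)) fun s _ => h.le_zero s
  simp only [intervalIntegral.integral_const, smul_eq_mul] at this
  linarith

/-- The window `[r - x, r + x]` contains one of half-width `min x r` around `r`, inside `[0, 2 *
r]`, where `K` is at least `K (2 * r)`. -/
lemma le_setIntegral_sumDiff {x r : ℝ} (hx : 0 ≤ x) (hr : 0 ≤ r) :
    2 * K (2 * r) * min x r ≤ ∫ t in Ioi r, sumDiffKernel K x t := by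
  rw [h.setIntegral_sumDiff_eq]
  have hm : 0 ≤ min x r := le_min hx hr
  have h1 := min_le_left x r
  have h2 := min_le_right x r
  have key := intervalIntegral.integral_mono_on (μ := volume) (a := r - min x r)
    (b := r + min x r) (by linarith)
    (intervalIntegrable_const (c := K (2 * r))) (h.cont.intervalIntegrable _ _) fun s hs =>
      h.le_of_abs_le (x := s) (y := 2 * r) (by
        rw [abs_of_nonneg (by linarith [hs.1]), abs_of_nonneg (by linarith)]; linarith [hs.2])
  have h3 : ∫ s in (r - min x r)..(r + min x r), K s ≤ ∫ s in (r - x)..(r + x), K s :=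
    intervalIntegral.integral_mono_interval (by linarith) (by linarith) (by linarith)
      (ae_of_all _ fun t => (h.pos t).le) (h.cont.intervalIntegrable _ _)
  simp only [intervalIntegral.integral_const, smul_eq_mul] at key
  linarith

/-! ### The integral operator on functions dominated by `C * (1 + μ)` -/

section Operator

variable {μ : ℝ → ℝ} (hμ : IntegrableOn μ (Ioi 0)) (hμ0 : ∀ t, 0 ≤ t → 0 < μ t)
include hμ

lemma integrableOn_sumDiff_mul_one_add (x : ℝ) :
    IntegrableOn (fun t => sumDiffKernel K x t * (1 + μ t)) (Ioi 0) := by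
  simp only [mul_add, mul_one]
  refine (h.integrable_sumDiff x).integrableOn.add ?_
  have hc : Continuous (sumDiffKernel K x) :=
    h.continuous_sumDiff.comp (Continuous.prodMk_right x)
  exact hμ.bdd_mul (c := K 0) hc.aestronglyMeasurable (ae_of_all _ fun t => h.abs_sumDiff_le x t)

include hμ0

lemma integrableOn_sumDiff_mul {g : ℝ → ℝ} {C : ℝ}
    (hg : AEStronglyMeasurable g (volume.restrict (Ioi 0)))
    (hgC : ∀ t, 0 < t → |g t| ≤ C * (1 + μ t)) (x : ℝ) :
    IntegrableOn (fun t => sumDiffKernel K x t * g t) (Ioi 0) := by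
  have hc : Continuous (sumDiffKernel K x) :=
    h.continuous_sumDiff.comp (Continuous.prodMk_right x)
  refine Integrable.mono' ((h.integrableOn_sumDiff_mul_one_add hμ x).norm.const_mul C)
    (hc.aestronglyMeasurable.mul hg) ?_
  filter_upwards [ae_restrict_mem measurableSet_Ioi] with t ht
  have h1 : 0 < 1 + μ t := by linarith [hμ0 t (le_of_lt ht)]
  rw [norm_mul, norm_mul, Real.norm_of_nonneg h1.le, Real.norm_eq_abs (g t)]
  nlinarith [mul_le_mul_of_nonneg_left (hgC t ht) (norm_nonneg (sumDiffKernel K x t))]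

lemma integral_sumDiff_mul_one_add_lt {x : ℝ} :
    ∫ t in Ioi 0, sumDiffKernel K x t * (1 + μ t) < 1 + (∫ t in Ioi 0, μ t) * K 0 := by
  have hc : Continuous (sumDiffKernel K x) :=
    h.continuous_sumDiff.comp (Continuous.prodMk_right x)
  have hi : IntegrableOn (fun t => sumDiffKernel K x t * μ t) (Ioi 0) :=
    hμ.bdd_mul (c := K 0) hc.aestronglyMeasurable (ae_of_all _ fun t => h.abs_sumDiff_le x t)
  simp only [mul_add, mul_one]
  rw [integral_add (h.integrable_sumDiff x).integrableOn hi]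
  refine add_lt_add_of_lt_of_le (h.integral_sumDiff_lt_one x) ?_
  rw [mul_comm, ← integral_const_mul]
  refine setIntegral_mono_on hi (hμ.const_mul _) measurableSet_Ioi fun t ht => ?_
  exact mul_le_mul_of_nonneg_right ((le_abs_self _).trans (h.abs_sumDiff_le x t))
    (hμ0 t (le_of_lt ht)).le

lemma integral_sumDiff_mul_one_add_le_linear {x : ℝ} (hx : 0 ≤ x) :
    ∫ t in Ioi 0, sumDiffKernel K x t * (1 + μ t) ≤
      (2 * K 0 + 2 * L * ∫ t in Ioi 0, μ t) * x := by
  have hc : Continuous (sumDiffKernel K x) :=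
    h.continuous_sumDiff.comp (Continuous.prodMk_right x)
  have hi : IntegrableOn (fun t => sumDiffKernel K x t * μ t) (Ioi 0) :=
    hμ.bdd_mul (c := K 0) hc.aestronglyMeasurable (ae_of_all _ fun t => h.abs_sumDiff_le x t)
  simp only [mul_add, mul_one]
  rw [integral_add (h.integrable_sumDiff x).integrableOn hi]
  have h2 : ∫ t in Ioi 0, sumDiffKernel K x t * μ t ≤ 2 * L * x * ∫ t in Ioi 0, μ t := by
    rw [← integral_const_mul]
    refine setIntegral_mono_on hi (hμ.const_mul _) measurableSet_Ioi fun t ht => ?_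
    exact mul_le_mul_of_nonneg_right (h.sumDiff_le_linear hx t) (hμ0 t (le_of_lt ht)).le
  linarith [h.integral_sumDiff_le_linear hx]

lemma continuous_integral_sumDiff_mul {g : ℝ → ℝ} {C : ℝ}
    (hg : AEStronglyMeasurable g (volume.restrict (Ioi 0)))
    (hgC : ∀ t, 0 < t → |g t| ≤ C * (1 + μ t)) :
    Continuous fun x => ∫ t in Ioi 0, sumDiffKernel K x t * g t := by
  have hC : 0 ≤ C := by
    have h1 := (abs_nonneg _).trans (hgC 1 one_pos)
    have h2 := hμ0 1 zero_le_one
    exact nonneg_of_mul_nonneg_left h1 (by linarith)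
  refine continuous_iff_continuousAt.2 fun x₀ => ?_
  set R := |x₀| + 1 with hR
  have hR0 : 0 < R := by positivity
  -- Majorant uniform in `|x| ≤ R`: up to `R` the kernel is bounded by `K 0`, and beyond it `|x - t|
  -- ≥ t - R`.
  let b : ℝ → ℝ := fun t => 2 * ((Ioc 0 R).indicator (fun _ => K 0) t + K (R - t))
  have hb : IntegrableOn b (Ioi 0) := by
    have h1 : Integrable ((Ioc 0 R).indicator fun _ : ℝ => K 0) :=
      (integrable_indicator_iff measurableSet_Ioc).2 (by simp [integrableOn_const_iff])
    exact ((h1.add (h.integrable_comp_sub R)).const_mul 2).integrableOn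
  have hKb : ∀ x t, |x| ≤ R → 0 < t → K (x - t) ≤ b t / 2 := by
    intro x t hx ht
    have hbt : b t / 2 = (Ioc 0 R).indicator (fun _ => K 0) t + K (R - t) := by
      simp only [b]; ring
    rw [hbt]
    by_cases htR : t ≤ R
    · rw [indicator_of_mem (show t ∈ Ioc 0 R from ⟨ht, htR⟩)]
      linarith [h.le_zero (x - t), h.pos (R - t)]
    · rw [indicator_of_notMem (fun H => htR H.2), zero_add]
      push Not at htR
      have := abs_le.1 hx
      refine h.le_of_abs_le ?_
      rw [abs_of_neg (by linarith), abs_of_nonpos (by linarith)]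
      linarith
  have hkb : ∀ x t, |x| ≤ R → 0 < t → |sumDiffKernel K x t| ≤ b t := by
    intro x t hx ht
    have h1 := hKb x t hx ht
    have h2 := hKb (-x) t (by rwa [abs_neg]) ht
    rw [show -x - t = -(x + t) by ring, h.even] at h2
    have h3 := h.pos (x - t)
    have h4 := h.pos (x + t)
    unfold sumDiffKernel
    exact abs_le.2 ⟨by linarith, by linarith⟩
  refine continuousAt_of_dominated (bound := fun t => C * (b t + K 0 * μ t)) ?_ ?_ ?_ ?_
  · refine Eventually.of_forall fun x => ?_
    have hc : Continuous (sumDiffKernel K x) :=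
      h.continuous_sumDiff.comp (Continuous.prodMk_right x)
    exact hc.aestronglyMeasurable.mul hg
  · have : ∀ᶠ x in 𝓝 x₀, |x| < R := continuous_abs.continuousAt.eventually_lt
      continuousAt_const (by rw [hR]; linarith)
    filter_upwards [this] with x hx
    filter_upwards [ae_restrict_mem measurableSet_Ioi] with t ht
    have h1 := hkb x t hx.le ht
    have h2 := h.abs_sumDiff_le x t
    have h3 := hgC t ht
    have h4 := hμ0 t (le_of_lt ht)
    rw [norm_mul, Real.norm_eq_abs, Real.norm_eq_abs]
    calc _ ≤ |sumDiffKernel K x t| * (C * (1 + μ t)) :=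
          mul_le_mul_of_nonneg_left h3 (abs_nonneg _)
      _ = C * (|sumDiffKernel K x t| + |sumDiffKernel K x t| * μ t) := by ring
      _ ≤ _ := by gcongr
  · exact (hb.add (hμ.const_mul _)).const_mul C
  · refine ae_of_all _ fun t => ContinuousAt.mul ?_ continuousAt_const
    exact (h.continuous_sumDiff.comp (Continuous.prodMk_left t)).continuousAt

end Operator

end EvenDecreasingKernel

/-! ### The scaling function and the nonlinearity. -/

/-- A concave self-map of `[0, 1]` fixing the endpoints, other than the identity, lies strictly
above the diagonal on `(0, 1)`. -/
lemma ConcaveOn.lt_of_ne_id {φ : ℝ → ℝ} (hφ : ConcaveOn ℝ (Icc 0 1) φ) (h0 : φ 0 = 0)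
    (h1 : φ 1 = 1) (hne : ∃ σ ∈ Ioo (0 : ℝ) 1, φ σ ≠ σ) {σ : ℝ} (hσ : σ ∈ Ioo (0 : ℝ) 1) :
    σ < φ σ := by
  have m0 : (0 : ℝ) ∈ Icc (0 : ℝ) 1 := by simp
  have m1 : (1 : ℝ) ∈ Icc (0 : ℝ) 1 := by simp
  have hle : ∀ τ ∈ Ioo (0 : ℝ) 1, τ ≤ φ τ := by
    intro τ hτ
    have := hφ.2 m0 m1 (show 0 ≤ 1 - τ by linarith [hτ.2]) hτ.1.le (by ring)
    simpa [h0, h1] using this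
  obtain ⟨τ, hτ, hτne⟩ := hne
  have hlt : τ < φ τ := lt_of_le_of_ne (hle τ hτ) hτne.symm
  have mτ : τ ∈ Icc (0 : ℝ) 1 := ⟨hτ.1.le, hτ.2.le⟩
  obtain ⟨hτ0, hτ1⟩ := hτ
  obtain ⟨hσ0, hσ1⟩ := hσ
  -- Inside `(0, 1)` the chords joining `(τ, φ τ)` to `(0, 0)` and to `(1, 1)` lie strictly above
  -- the diagonal.
  rcases le_total σ τ with hc | hc
  · have hdiv : σ / τ ≤ 1 := (div_le_one hτ0).2 hc
    have hpos : 0 < σ / τ := div_pos hσ0 hτ0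
    have := hφ.2 m0 mτ (show 0 ≤ 1 - σ / τ by linarith) hpos.le (by ring)
    simp only [smul_eq_mul, h0, mul_zero, zero_add, div_mul_cancel₀ σ hτ0.ne'] at this
    calc σ = σ / τ * τ := (div_mul_cancel₀ σ hτ0.ne').symm
      _ < σ / τ * φ τ := mul_lt_mul_of_pos_left hlt hpos
      _ ≤ φ σ := this
  · have hτ' : 0 < 1 - τ := by linarith
    have hpos : 0 < (1 - σ) / (1 - τ) := div_pos (by linarith) hτ'
    have hdiv : (1 - σ) / (1 - τ) ≤ 1 := (div_le_one hτ').2 (by linarith)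
    set a := (1 - σ) / (1 - τ)
    have ha : a * (1 - τ) = 1 - σ := div_mul_cancel₀ _ hτ'.ne'
    have := hφ.2 mτ m1 hpos.le (show 0 ≤ 1 - a by linarith) (by ring)
    simp only [smul_eq_mul, h1, mul_one] at this
    rw [show a * τ + (1 - a) = σ by linarith] at this
    nlinarith [mul_lt_mul_of_pos_left hlt hpos]

/-- Properties of the nonlinearity: `Q ξ = A * ξ`, and `φ` measures the deviation of the inverse
of `Q` from homogeneity below `ξ`. -/
structure SublinearInverse (Q φ : ℝ → ℝ) (A ξ : ℝ) : Prop where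
  zero : Q 0 = 0
  cont : ContinuousOn Q (Ici 0)
  mono : StrictMonoOn Q (Ici 0)
  convex : ConvexOn ℝ (Ici 0) Q
  xi_pos : 0 < ξ
  coeff_pos : 0 < A
  apply_xi : Q ξ = A * ξ
  maps : MapsTo φ (Icc 0 1) (Icc 0 1)
  lt : ∀ σ ∈ Ioo (0 : ℝ) 1, σ < φ σ
  scale : ∀ σ ∈ Ioo (0 : ℝ) 1, ∀ v, 0 ≤ v → v < ξ → Q (φ σ * v) ≤ σ * Q v

/-- The inverse of a superlinear increasing function on the half-line, extended continuously and
monotonically to the whole line. -/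
lemma exists_continuous_monotone_inverse {Q : ℝ → ℝ} {ξ : ℝ} (zero : Q 0 = 0)
    (cont : ContinuousOn Q (Ici 0)) (mono : StrictMonoOn Q (Ici 0))
    (convex : ConvexOn ℝ (Ici 0) Q) (hξ : 0 < ξ) :
    ∃ G : ℝ → ℝ, Continuous G ∧ Monotone G ∧ (∀ y, 0 ≤ y → 0 ≤ G y ∧ Q (G y) = y) ∧
      ∀ v, 0 ≤ v → G (Q v) = v := by
  have hQξ : 0 < Q ξ := by
    have := mono (mem_Ici.2 le_rfl) (mem_Ici.2 hξ.le) hξ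
    rwa [zero] at this
  -- Gluing `Q` to the identity on the negative axis gives an increasing homeomorphism of the line.
  let E : ℝ → ℝ := fun x => Q (max x 0) + min x 0
  have hE0 : ∀ x, 0 ≤ x → E x = Q x := fun x hx => by simp [E, hx]
  have hEn : ∀ x, x ≤ 0 → E x = x := fun x hx => by simp [E, hx, zero]
  have hc : Continuous E := by
    refine Continuous.add ?_ (by fun_prop)
    exact cont.comp_continuous (by fun_prop) fun x => mem_Ici.2 (le_max_right _ _)
  have hm : StrictMono E := by
    intro x y hxy
    rcases le_or_gt 0 x with hx | hx
    · rw [hE0 x hx, hE0 y (hx.trans hxy.le)]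
      exact mono hx (hx.trans hxy.le : (0 : ℝ) ≤ y) hxy
    · rw [hEn x hx.le]
      rcases le_total y 0 with hy | hy
      · rwa [hEn y hy]
      · rw [hE0 y hy]
        have := mono.monotoneOn (mem_Ici.2 le_rfl) (mem_Ici.2 hy) hy
        rw [zero] at this
        linarith
  have htop : Tendsto E atTop atTop := by
    have : Tendsto (fun x : ℝ => Q ξ / ξ * x) atTop atTop :=
      tendsto_id.const_mul_atTop (div_pos hQξ hξ)
    refine tendsto_atTop_mono' _ ?_ this
    filter_upwards [eventually_ge_atTop ξ] with u hu
    have hu0 : 0 < u := hξ.trans_le hu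
    rw [hE0 u hu0.le]
    have h1 : ξ / u ≤ 1 := (div_le_one hu0).2 hu
    have := convex.2 (mem_Ici.2 le_rfl) (mem_Ici.2 hu0.le) 
      (show 0 ≤ 1 - ξ / u by linarith) (show 0 ≤ ξ / u by positivity) (by ring)
    simp only [smul_eq_mul, mul_zero, zero_add, div_mul_cancel₀ ξ hu0.ne', zero] at this
    rw [div_mul_eq_mul_div, div_le_iff₀ hξ]
    rw [div_mul_eq_mul_div, le_div_iff₀ hu0] at this
    linarith
  have hbot : Tendsto E atBot atBot := by
    refine tendsto_id.congr' ?_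
    filter_upwards [eventually_le_atBot 0] with u hu
    rw [hEn u hu, id]
  let e : ℝ ≃o ℝ := hm.orderIsoOfSurjective E (hc.surjective htop hbot)
  have he : ∀ x, e x = E x := fun x => rfl
  refine ⟨e.symm, e.symm.continuous, e.symm.monotone, fun y hy => ?_, fun v hv => ?_⟩
  · have h0 : 0 ≤ e.symm y := by
      rw [e.le_symm_apply, he, hE0 0 le_rfl, zero]; exact hy
    exact ⟨h0, by rw [← hE0 _ h0, ← he, e.apply_symm_apply]⟩
  · rw [← hE0 v hv, ← he, e.symm_apply_apply]

lemma halfLineInverse_apply {Q : ℝ → ℝ} (mono : StrictMonoOn Q (Ici 0)) {v : ℝ} (hv : 0 ≤ v) :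
    halfLineInverse Q (Q v) = v :=
  mono.injOn.leftInvOn_invFunOn hv

/-- The scaling inequality for the inverse of `Q`, expressed through `Q` itself. -/
lemma scale_of_halfLineInverse {Q φ : ℝ → ℝ} {ξ : ℝ} (zero : Q 0 = 0)
    (cont : ContinuousOn Q (Ici 0)) (mono : StrictMonoOn Q (Ici 0))
    (convex : ConvexOn ℝ (Ici 0) Q) (hξ : 0 < ξ) (maps : MapsTo φ (Icc 0 1) (Icc 0 1))
    (hG : ∀ σ ∈ Ioo (0 : ℝ) 1, ∀ u ∈ Ioo (0 : ℝ) (Q ξ),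
      φ σ * halfLineInverse Q u ≤ halfLineInverse Q (σ * u)) {σ : ℝ} (hσ : σ ∈ Ioo (0 : ℝ) 1)
    {v : ℝ} (hv : 0 ≤ v) (hvξ : v < ξ) : Q (φ σ * v) ≤ σ * Q v := by
  obtain ⟨G, -, -, hGQ, -⟩ := exists_continuous_monotone_inverse zero cont mono convex hξ
  rcases hv.eq_or_lt with rfl | hv0
  · simp [zero]
  have hQv : 0 < Q v := by
    have := mono (mem_Ici.2 le_rfl) (mem_Ici.2 hv) hv0
    rwa [zero] at this
  have h1 := hG σ hσ (Q v) ⟨hQv, mono hv hξ.le hvξ⟩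
  obtain ⟨hw0, hw⟩ := hGQ (σ * Q v) (mul_nonneg hσ.1.le hQv.le)
  rw [halfLineInverse_apply mono hv, ← hw, halfLineInverse_apply mono hw0] at h1
  rw [← hw]
  exact mono.monotoneOn
    (mul_nonneg (maps ⟨hσ.1.le, hσ.2.le⟩).1 hv : (0 : ℝ) ≤ φ σ * v) hw0 h1

namespace SublinearInverse

variable {Q φ : ℝ → ℝ} {A ξ : ℝ} (h : SublinearInverse Q φ A ξ)
include h

lemma le_iff {u v : ℝ} (hu : 0 ≤ u) (hv : 0 ≤ v) : Q u ≤ Q v ↔ u ≤ v := h.mono.le_iff_le hu hv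

lemma lt_iff {u v : ℝ} (hu : 0 ≤ u) (hv : 0 ≤ v) : Q u < Q v ↔ u < v := h.mono.lt_iff_lt hu hv

lemma nonneg {u : ℝ} (hu : 0 ≤ u) : 0 ≤ Q u := by
  have := (h.le_iff le_rfl hu).2 hu
  rwa [h.zero] at this

/-- `Q v / v` takes arbitrarily small values below `ξ`. -/
lemma exists_apply_le_mul {c : ℝ} (hc : 0 < c) : ∃ ε, 0 < ε ∧ ε < ξ ∧ Q ε ≤ c * ε := by
  -- Scaling `v` by `s = φ (1 / 2) > 1 / 2` at least halves `Q v`, so each iteration multiplies the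
  -- bound on `Q v / v` by `1 / (2 * s) < 1`.
  have hhalf : (1 / 2 : ℝ) ∈ Ioo (0 : ℝ) 1 := by norm_num
  set s := φ (1 / 2)
  have hs : 1 / 2 < s := h.lt _ hhalf
  have hs1 : s ≤ 1 := (h.maps ⟨hhalf.1.le, hhalf.2.le⟩).2
  have hs0 : 0 < s := by linarith
  have hξ := h.xi_pos
  have hlt : ∀ n : ℕ, s ^ n * (ξ / 2) < ξ := fun n => by
    nlinarith [pow_le_one₀ (n := n) hs0.le hs1]
  have hstep : ∀ n : ℕ, Q (s ^ n * (ξ / 2)) ≤ (1 / 2) ^ n * Q (ξ / 2) := by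
    intro n
    induction n with
    | zero => simp
    | succ n ih =>
      have := h.scale _ hhalf (s ^ n * (ξ / 2)) (by positivity) (hlt n)
      rw [← mul_assoc, ← pow_succ'] at this
      refine this.trans ?_
      rw [pow_succ']
      linarith
  have hlim : Tendsto (fun n : ℕ => (1 / 2 / s) ^ n * Q (ξ / 2)) atTop (𝓝 (0 * Q (ξ / 2))) :=
    (tendsto_pow_atTop_nhds_zero_of_lt_one (by positivity) ((div_lt_one hs0).2 hs)).mul_const _
  rw [zero_mul] at hlim
  obtain ⟨n, hn⟩ := (hlim.eventually_lt_const (show 0 < c * (ξ / 2) by positivity)).exists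
  refine ⟨s ^ n * (ξ / 2), by positivity, hlt n, (hstep n).trans ?_⟩
  have hsn : 0 < s ^ n := by positivity
  rw [div_pow, div_mul_eq_mul_div, div_lt_iff₀ hsn] at hn
  linarith

/-- The graph of `Q` lies strictly below the line of slope `A` at some `ε < ξ` and meets it at `ξ`;
by convexity it cannot be on or below that line past `ξ`. -/
lemma le_xi_of_apply_le {C : ℝ} (hC : Q C ≤ A * C) : C ≤ ξ := by
  by_contra! hlt
  have hξ := h.xi_pos
  have hA := h.coeff_pos
  obtain ⟨ε, hε0, hεξ, hε⟩ := h.exists_apply_le_mul (half_pos hA)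
  have hden : 0 < C - ε := by linarith
  set b := (ξ - ε) / (C - ε)
  have hb : b * (C - ε) = ξ - ε := div_mul_cancel₀ _ hden.ne'
  have hb0 : 0 < b := div_pos (by linarith) hden
  have hb1 : b < 1 := (div_lt_one hden).2 (by linarith)
  have := h.convex.2 (mem_Ici.2 hε0.le) (mem_Ici.2 (hξ.trans hlt).le) 
    (show 0 ≤ 1 - b by linarith) hb0.le (by ring)
  simp only [smul_eq_mul] at this
  rw [show (1 - b) * ε + b * C = ξ by linarith, h.apply_xi] at this
  have e : A * ξ = (1 - b) * (A * ε) + b * (A * C) := by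
    rw [show ξ = (1 - b) * ε + b * C by linarith]; ring
  have h1 : b * Q C ≤ b * (A * C) := mul_le_mul_of_nonneg_left hC hb0.le
  have h2 : (1 - b) * Q ε < (1 - b) * (A * ε) :=
    mul_lt_mul_of_pos_left (by nlinarith) (by linarith)
  linarith

end SublinearInverse

/-! ### The perturbation. -/

/-- A continuous perturbation, monotone and concave in the second variable, vanishing at `0` and
dominated by `μ t * u` with `μ` integrable. -/
structure ConcavePerturbation (ω : ℝ → ℝ → ℝ) (μ : ℝ → ℝ) : Prop where
  cont : ContinuousOn (fun p : ℝ × ℝ => ω p.1 p.2) (Ici 0 ×ˢ Ici 0)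
  mono : ∀ t, 0 ≤ t → MonotoneOn (ω t) (Ici 0)
  concave : ∀ t, 0 ≤ t → ConcaveOn ℝ (Ici 0) (ω t)
  zero : ∀ t, 0 ≤ t → ω t 0 = 0
  le : ∀ t u, 0 ≤ t → 0 ≤ u → ω t u ≤ μ t * u
  integrableOn : IntegrableOn μ (Ioi 0)
  pos : ∀ t, 0 ≤ t → 0 < μ t

namespace ConcavePerturbation

variable {ω : ℝ → ℝ → ℝ} {μ : ℝ → ℝ} (h : ConcavePerturbation ω μ)
include h

lemma integral_nonneg : 0 ≤ ∫ t in Ioi 0, μ t :=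
  setIntegral_nonneg measurableSet_Ioi fun t ht => (h.pos t (le_of_lt ht)).le

lemma add_mono {t u v : ℝ} (ht : 0 ≤ t) (hu : 0 ≤ u) (huv : u ≤ v) : u + ω t u ≤ v + ω t v :=
  add_le_add huv (h.mono t ht hu (hu.trans huv : (0 : ℝ) ≤ v) huv)

lemma self_le {t u : ℝ} (ht : 0 ≤ t) (hu : 0 ≤ u) : u ≤ u + ω t u := by
  have := h.mono t ht (mem_Ici.2 le_rfl) (mem_Ici.2 hu) hu
  rw [h.zero t ht] at this
  linarith

lemma le_mul_one_add {t u C : ℝ} (ht : 0 ≤ t) (hu : 0 ≤ u) (huC : u ≤ C) :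
    u + ω t u ≤ C * (1 + μ t) := by
  have h1 := h.le t u ht hu
  have h2 := mul_le_mul_of_nonneg_left huC (h.pos t ht).le
  linarith

lemma abs_le_mul_one_add {t u C : ℝ} (ht : 0 ≤ t) (hu : 0 ≤ u) (huC : u ≤ C) :
    |u + ω t u| ≤ C * (1 + μ t) := by
  rw [abs_of_nonneg (hu.trans (h.self_le ht hu))]
  exact h.le_mul_one_add ht hu huC

lemma mul_add_le {t u s : ℝ} (ht : 0 ≤ t) (hu : 0 ≤ u) (hs0 : 0 ≤ s) (hs1 : s ≤ 1) :
    s * (u + ω t u) ≤ s * u + ω t (s * u) := by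
  have := (h.concave t ht).2 (mem_Ici.2 le_rfl) (mem_Ici.2 hu)
    (show 0 ≤ 1 - s by linarith) hs0 (by ring)
  simp only [smul_eq_mul, mul_zero, zero_add, h.zero t ht] at this
  linarith

/-- Clamping both variables to the half-line makes measurability and limits available on the whole
plane. -/
lemma continuous_extend : Continuous fun p : ℝ × ℝ => ω (max p.1 0) (max p.2 0) :=
  h.cont.comp_continuous (f := fun p : ℝ × ℝ => (max p.1 0, max p.2 0)) (by fun_prop)
    fun p => ⟨mem_Ici.2 (le_max_right _ _), mem_Ici.2 (le_max_right _ _)⟩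

lemma aestronglyMeasurable {B : ℝ → ℝ} (hB : Measurable B) (hB0 : ∀ t, 0 ≤ t → 0 ≤ B t) :
    AEStronglyMeasurable (fun t => B t + ω t (B t)) (volume.restrict (Ioi 0)) := by
  have hm : Measurable fun t => B t + ω (max t 0) (max (B t) 0) :=
    hB.add (h.continuous_extend.measurable.comp (measurable_id.prodMk hB))
  refine hm.aestronglyMeasurable.congr ?_
  filter_upwards [ae_restrict_mem measurableSet_Ioi] with t ht
  rw [max_eq_left (le_of_lt ht), max_eq_left (hB0 t (le_of_lt ht))]

lemma tendsto {t : ℝ} (ht : 0 ≤ t) {u : ℕ → ℝ} {v : ℝ} (hu0 : ∀ n, 0 ≤ u n) (hv0 : 0 ≤ v)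
    (huv : Tendsto u atTop (𝓝 v)) :
    Tendsto (fun n => u n + ω t (u n)) atTop (𝓝 (v + ω t v)) := by
  have := (h.continuous_extend.tendsto (t, v)).comp ((tendsto_const_nhds (x := t)).prodMk_nhds huv)
  refine huv.add ?_
  simpa [Function.comp_def, max_eq_left ht, max_eq_left hv0, max_eq_left (hu0 _)] using this

end ConcavePerturbation

/-! ### A priori bounds and uniqueness. -/

section Equation

variable {K : ℝ → ℝ} {L : ℝ} {ω : ℝ → ℝ → ℝ} {μ Q φ : ℝ → ℝ} {ξ : ℝ}
  (hK : EvenDecreasingKernel K L) (hω : ConcavePerturbation ω μ)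
  (hQ : SublinearInverse Q φ (1 + constM K μ) ξ)
include hK hω

lemma integral_source_le {B : ℝ → ℝ} {C x : ℝ} (hx : 0 ≤ x)
    (hi : IntegrableOn (fun t => sumDiffKernel K x t * (B t + ω t (B t))) (Ioi 0))
    (hB : ∀ t, 0 ≤ t → 0 ≤ B t ∧ B t ≤ C) :
    ∫ t in Ioi 0, sumDiffKernel K x t * (B t + ω t (B t)) ≤
      C * ∫ t in Ioi 0, sumDiffKernel K x t * (1 + μ t) := by
  rw [← integral_const_mul]
  refine setIntegral_mono_on hi
    ((hK.integrableOn_sumDiff_mul_one_add hω.integrableOn x).const_mul C) measurableSet_Ioi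
    fun t ht => ?_
  have ht0 : 0 ≤ t := le_of_lt ht
  have h1 := mul_le_mul_of_nonneg_left
    (hω.le_mul_one_add ht0 (hB t ht0).1 (hB t ht0).2) (hK.sumDiff_nonneg hx ht0)
  linarith

lemma integral_mul_one_add_lt (x : ℝ) :
    ∫ t in Ioi 0, sumDiffKernel K x t * (1 + μ t) < 1 + constM K μ := by
  rw [constM, hK.iSup_eq]
  exact hK.integral_sumDiff_mul_one_add_lt hω.integrableOn hω.pos

/-- A function bounded below by `a` on `(r, ∞)` is mapped above a multiple of `min x r`. -/
lemma le_integral_source {B : ℝ → ℝ} {a r x : ℝ} (hx : 0 ≤ x) (hr : 0 ≤ r) (ha : 0 ≤ a)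
    (hi : IntegrableOn (fun t => sumDiffKernel K x t * (B t + ω t (B t))) (Ioi 0))
    (hB : ∀ t, 0 ≤ t → 0 ≤ B t) (hBa : ∀ t, r < t → a ≤ B t) :
    a * (2 * K (2 * r) * min x r) ≤
      ∫ t in Ioi 0, sumDiffKernel K x t * (B t + ω t (B t)) := by
  have hsub : Ioi r ⊆ Ioi 0 := Ioi_subset_Ioi hr
  calc a * (2 * K (2 * r) * min x r) ≤ a * ∫ t in Ioi r, sumDiffKernel K x t :=
        mul_le_mul_of_nonneg_left (hK.le_setIntegral_sumDiff hx hr) ha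
    _ = ∫ t in Ioi r, a * sumDiffKernel K x t := (integral_const_mul _ _).symm
    _ ≤ ∫ t in Ioi r, sumDiffKernel K x t * (B t + ω t (B t)) := by
        refine setIntegral_mono_on ((hK.integrable_sumDiff x).integrableOn.const_mul a)
          (hi.mono_set hsub) measurableSet_Ioi fun t ht => ?_
        have ht0 : 0 ≤ t := le_of_lt (hsub ht)
        rw [mul_comm]
        exact mul_le_mul_of_nonneg_left ((hBa t ht).trans (hω.self_le ht0 (hB t ht0)))
          (hK.sumDiff_nonneg hx ht0)
    _ ≤ _ := by
        refine setIntegral_mono_set hi ?_ (LE.le.eventuallyLE hsub)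
        filter_upwards [ae_restrict_mem measurableSet_Ioi] with t ht
        have ht0 : 0 ≤ t := le_of_lt ht
        exact mul_nonneg (hK.sumDiff_nonneg hx ht0) ((hB t ht0).trans (hω.self_le ht0 (hB t ht0)))

omit hK hω in
lemma InClassM.exists_lower_bound {B : ℝ → ℝ} (hB : InClassM B) :
    ∃ r a, 0 < r ∧ 0 < a ∧ ∀ t, r < t → a ≤ B t := by
  obtain ⟨-, h0, r, hr, ha⟩ := hB
  refine ⟨r, _, hr, ha, fun t ht => csInf_le ⟨0, ?_⟩ (mem_image_of_mem B ht)⟩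
  rintro _ ⟨s, hs, rfl⟩
  exact h0 s (hr.trans hs).le

include hQ

/-- Every solution in the class stays strictly below `ξ`. -/
lemma IsSolution.lt_xi {B : ℝ → ℝ} (hB : InClassM B) (hs : IsSolution K ω Q B) {x : ℝ}
    (hx : 0 ≤ x) : B x < ξ := by
  obtain ⟨⟨D, hD⟩, h0, -⟩ := hB
  set C := sSup (B '' Ici 0)
  have hbdd : BddAbove (B '' Ici 0) :=
    ⟨D, by rintro _ ⟨t, ht, rfl⟩; exact (le_abs_self _).trans (hD t ht)⟩
  have hC : ∀ t, 0 ≤ t → B t ≤ C := fun t ht => le_csSup hbdd (mem_image_of_mem B ht)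
  have hC0 : 0 ≤ C := (h0 0 le_rfl).trans (hC 0 le_rfl)
  have hA := hQ.coeff_pos
  have key : ∀ x, 0 ≤ x → Q (B x) ≤ C * ∫ t in Ioi 0, sumDiffKernel K x t * (1 + μ t) := by
    intro x hx
    rw [(hs x hx).2]
    exact integral_source_le hK hω hx (hs x hx).1 fun t ht => ⟨h0 t ht, hC t ht⟩
  obtain ⟨G, -, -, hG, -⟩ :=
    exists_continuous_monotone_inverse hQ.zero hQ.cont hQ.mono hQ.convex hQ.xi_pos
  obtain ⟨hw0, hw⟩ := hG ((1 + constM K μ) * C) (mul_nonneg hA.le hC0)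
  -- The supremum need not be attained, so the bound on `Q (B t)` is transferred to `B t` before
  -- passing to `C`.
  have hCw : C ≤ G ((1 + constM K μ) * C) := by
    refine csSup_le ⟨_, mem_image_of_mem B (mem_Ici.2 le_rfl)⟩ ?_
    rintro _ ⟨t, ht, rfl⟩
    rw [← hQ.le_iff (h0 t ht) hw0, hw, mul_comm]
    exact (key t ht).trans (mul_le_mul_of_nonneg_left (integral_mul_one_add_lt hK hω t).le hC0)
  have hCξ : C ≤ ξ := hQ.le_xi_of_apply_le (by rw [← hw]; exact (hQ.le_iff hC0 hw0).2 hCw)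
  rw [← hQ.lt_iff (h0 x hx) hQ.xi_pos.le, hQ.apply_xi]
  have hpos : 0 ≤ ∫ t in Ioi 0, sumDiffKernel K x t * (1 + μ t) :=
    setIntegral_nonneg measurableSet_Ioi fun t ht => mul_nonneg
      (hK.sumDiff_nonneg hx (le_of_lt ht)) (by linarith [hω.pos t (le_of_lt ht)])
  have h1 := mul_le_mul_of_nonneg_right hCξ hpos
  have h2 := mul_lt_mul_of_pos_left (integral_mul_one_add_lt hK hω x) hQ.xi_pos
  linarith [key x hx]

/-- Two solutions in the class are comparable up to a positive factor. -/
lemma IsSolution.exists_mul_le {B B' : ℝ → ℝ} (hB : InClassM B) (hs : IsSolution K ω Q B)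
    (hB' : InClassM B') (hs' : IsSolution K ω Q B') :
    ∃ σ, 0 < σ ∧ σ ≤ 1 ∧ ∀ x, 0 ≤ x → σ * Q (B x) ≤ Q (B' x) := by
  obtain ⟨r, a, hr, ha, hBa⟩ := hB'.exists_lower_bound
  have hξ := hQ.xi_pos
  have hL := hK.lip_nonneg
  have hK0 := hK.pos 0
  have hKr := hK.pos (2 * r)
  have hA := hQ.coeff_pos
  have hμ := hω.integral_nonneg
  set A := 1 + constM K μ
  set D := 2 * K 0 + 2 * L * ∫ t in Ioi 0, μ t
  have hD : 0 < D := by positivity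
  -- The term `D` serves the linear bound for `x ≤ r`, the term `A / r` the constant bound for `x ≥
  -- r`.
  set E := ξ * (D + A / r)
  have hE : 0 < E := by positivity
  set c := a * (2 * K (2 * r))
  have hc : 0 < c := by positivity
  have hup : ∀ x, 0 ≤ x → Q (B x) ≤ E * min x r := by
    intro x hx
    rw [(hs x hx).2]
    refine (integral_source_le hK hω hx (hs x hx).1 (C := ξ)
      fun t ht => ⟨hB.2.1 t ht, (hs.lt_xi hK hω hQ hB ht).le⟩).trans ?_
    rw [mul_assoc]
    refine mul_le_mul_of_nonneg_left ?_ hξ.le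
    rcases le_total x r with hxr | hxr
    · rw [min_eq_left hxr]
      refine (hK.integral_sumDiff_mul_one_add_le_linear hω.integrableOn hω.pos hx).trans ?_
      exact mul_le_mul_of_nonneg_right (le_add_of_nonneg_right (by positivity)) hx
    · rw [min_eq_right hxr]
      refine (integral_mul_one_add_lt hK hω x).le.trans ?_
      rw [add_mul, div_mul_cancel₀ _ hr.ne']
      exact le_add_of_nonneg_left (by positivity)
  refine ⟨min 1 (c / E), lt_min one_pos (by positivity), min_le_left _ _, fun x hx => ?_⟩
  have hm : 0 ≤ min x r := le_min hx hr.le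
  have hQ0 := hQ.nonneg (hB.2.1 x hx)
  calc min 1 (c / E) * Q (B x) ≤ c / E * (E * min x r) := by
        exact mul_le_mul (min_le_right _ _) (hup x hx) hQ0 (by positivity)
    _ = a * (2 * K (2 * r) * min x r) := by
        rw [← mul_assoc, div_mul_cancel₀ _ hE.ne']; simp only [c]; ring
    _ ≤ Q (B' x) := by
        rw [(hs' x hx).2]
        exact le_integral_source hK hω hx hr.le ha.le (hs' x hx).1 hB'.2.1 hBa

/-- The set of admissible factors is compact, so it has a greatest element. If this were some `σ <
1`, scaling would give `φ σ * B ≤ B'`; integrating this with the concavity of `ω t` would make `φ σ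
> σ` admissible. -/
lemma IsSolution.le {B B' : ℝ → ℝ} (hB : InClassM B) (hs : IsSolution K ω Q B)
    (hB' : InClassM B') (hs' : IsSolution K ω Q B') {x : ℝ} (hx : 0 ≤ x) : B x ≤ B' x := by
  let S : Set ℝ := Icc 0 1 ∩ ⋂ x : Ici (0 : ℝ), {σ | σ * Q (B x) ≤ Q (B' x)}
  have hSc : IsCompact S := isCompact_Icc.inter_right
    (isClosed_iInter fun x => isClosed_le (by fun_prop) continuous_const)
  have hmem : ∀ σ, σ ∈ S ↔ (0 ≤ σ ∧ σ ≤ 1) ∧ ∀ x, 0 ≤ x → σ * Q (B x) ≤ Q (B' x) := by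
    intro σ
    simp [S]
  obtain ⟨σ₀, hσ0, hσ1, hσ⟩ := IsSolution.exists_mul_le hK hω hQ hB hs hB' hs'
  have hσ₀ : σ₀ ∈ S := (hmem σ₀).2 ⟨⟨hσ0.le, hσ1⟩, hσ⟩
  obtain ⟨σ, hσS, hσmax⟩ := hSc.exists_isGreatest ⟨σ₀, hσ₀⟩
  have hpos : 0 < σ := hσ0.trans_le (hσmax hσ₀)
  obtain ⟨⟨-, hle1⟩, hcmp⟩ := (hmem σ).1 hσS
  have hone : σ = 1 := by
    by_contra hne
    have hIoo : σ ∈ Ioo (0 : ℝ) 1 := ⟨hpos, lt_of_le_of_ne hle1 hne⟩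
    obtain ⟨hφ0, hφ1⟩ := hQ.maps (Ioo_subset_Icc_self hIoo)
    refine (hQ.lt σ hIoo).not_ge (hσmax ((hmem _).2 ⟨⟨hφ0, hφ1⟩, fun x hx => ?_⟩))
    have hBB' : ∀ t, 0 ≤ t → φ σ * B t ≤ B' t := fun t ht => by
      rw [← hQ.le_iff (mul_nonneg hφ0 (hB.2.1 t ht)) (hB'.2.1 t ht)]
      exact (hQ.scale σ hIoo _ (hB.2.1 t ht) (hs.lt_xi hK hω hQ hB ht)).trans (hcmp t ht)
    rw [(hs x hx).2, (hs' x hx).2, ← integral_const_mul]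
    refine setIntegral_mono_on ((hs x hx).1.const_mul _) (hs' x hx).1 measurableSet_Ioi
      fun t ht => ?_
    have ht0 : 0 ≤ t := le_of_lt ht
    rw [mul_left_comm]
    refine mul_le_mul_of_nonneg_left ?_ (hK.sumDiff_nonneg hx ht0)
    exact (hω.mul_add_le ht0 (hB.2.1 t ht0) hφ0 hφ1).trans
      (hω.add_mono ht0 (mul_nonneg hφ0 (hB.2.1 t ht0)) (hBB' t ht0))
  have := hcmp x hx
  rwa [hone, one_mul, hQ.le_iff (hB.2.1 x hx) (hB'.2.1 x hx)] at this

end Equation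

/-! ### Existence by monotone iteration. -/

/-- The right-hand side of the equation as an operator. -/
noncomputable def sourceIntegral (K : ℝ → ℝ) (ω : ℝ → ℝ → ℝ) (B : ℝ → ℝ) (x : ℝ) : ℝ :=
  ∫ t in Ioi (0 : ℝ), sumDiffKernel K x t * (B t + ω t (B t))

/-- Measurable functions lying, on the half-line, between `ε` times the indicator of `(1, ∞)` and
`ξ`. -/
structure IsTrapped (ε ξ : ℝ) (B : ℝ → ℝ) : Prop where
  meas : Measurable B
  nonneg : ∀ t, 0 ≤ t → 0 ≤ B t
  le : ∀ t, 0 ≤ t → B t ≤ ξ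
  ge : ∀ t, 1 < t → ε ≤ B t

section Existence

variable {K : ℝ → ℝ} {L : ℝ} {ω : ℝ → ℝ → ℝ} {μ Q φ G : ℝ → ℝ} {ξ ε : ℝ}
  (hK : EvenDecreasingKernel K L) (hω : ConcavePerturbation ω μ)
  (hQ : SublinearInverse Q φ (1 + constM K μ) ξ)

include hK hω

lemma IsTrapped.integrableOn {B : ℝ → ℝ} (hB : IsTrapped ε ξ B) (x : ℝ) :
    IntegrableOn (fun t => sumDiffKernel K x t * (B t + ω t (B t))) (Ioi 0) :=
  hK.integrableOn_sumDiff_mul hω.integrableOn hω.pos (hω.aestronglyMeasurable hB.meas hB.nonneg)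
    (fun t ht => hω.abs_le_mul_one_add ht.le (hB.nonneg t ht.le) (hB.le t ht.le)) x

lemma IsTrapped.continuous_sourceIntegral {B : ℝ → ℝ} (hB : IsTrapped ε ξ B) :
    Continuous (sourceIntegral K ω B) :=
  hK.continuous_integral_sumDiff_mul hω.integrableOn hω.pos
    (hω.aestronglyMeasurable hB.meas hB.nonneg)
    fun t ht => hω.abs_le_mul_one_add ht.le (hB.nonneg t ht.le) (hB.le t ht.le)

lemma IsTrapped.sourceIntegral_nonneg {B : ℝ → ℝ} (hB : IsTrapped ε ξ B) {x : ℝ} (hx : 0 ≤ x) :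
    0 ≤ sourceIntegral K ω B x :=
  setIntegral_nonneg measurableSet_Ioi fun t ht => mul_nonneg
    (hK.sumDiff_nonneg hx (le_of_lt ht))
    ((hB.nonneg t (le_of_lt ht)).trans (hω.self_le (le_of_lt ht) (hB.nonneg t (le_of_lt ht))))

lemma IsTrapped.sourceIntegral_mono {B B' : ℝ → ℝ} (hB : IsTrapped ε ξ B)
    (hB' : IsTrapped ε ξ B') (hle : ∀ t, 0 ≤ t → B t ≤ B' t) {x : ℝ} (hx : 0 ≤ x) :
    sourceIntegral K ω B x ≤ sourceIntegral K ω B' x :=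
  setIntegral_mono_on (hB.integrableOn hK hω x) (hB'.integrableOn hK hω x) measurableSet_Ioi
    fun t ht => mul_le_mul_of_nonneg_left
      (hω.add_mono (le_of_lt ht) (hB.nonneg t (le_of_lt ht)) (hle t (le_of_lt ht)))
      (hK.sumDiff_nonneg hx (le_of_lt ht))

lemma IsTrapped.tendsto_sourceIntegral {u : ℕ → ℝ → ℝ} {B : ℝ → ℝ}
    (hu : ∀ n, IsTrapped ε ξ (u n)) (hB : IsTrapped ε ξ B)
    (hlim : ∀ t, 0 ≤ t → Tendsto (fun n => u n t) atTop (𝓝 (B t))) (x : ℝ) :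
    Tendsto (fun n => sourceIntegral K ω (u n) x) atTop (𝓝 (sourceIntegral K ω B x)) := by
  refine tendsto_integral_of_dominated_convergence
    (fun t => ξ * ‖sumDiffKernel K x t * (1 + μ t)‖)
    (fun n => ((hu n).integrableOn hK hω x).aestronglyMeasurable)
    ((hK.integrableOn_sumDiff_mul_one_add hω.integrableOn x).norm.const_mul ξ) (fun n => ?_) ?_
  · filter_upwards [ae_restrict_mem measurableSet_Ioi] with t ht
    have ht0 : 0 ≤ t := le_of_lt ht
    have h1 : 0 < 1 + μ t := by linarith [hω.pos t ht0]
    have h2 := hω.abs_le_mul_one_add ht0 ((hu n).nonneg t ht0) ((hu n).le t ht0)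
    rw [norm_mul, norm_mul, Real.norm_of_nonneg h1.le, Real.norm_eq_abs (_ + _)]
    linarith [mul_le_mul_of_nonneg_left h2 (norm_nonneg (sumDiffKernel K x t))]
  · filter_upwards [ae_restrict_mem measurableSet_Ioi] with t ht
    have ht0 : 0 ≤ t := le_of_lt ht
    exact (hω.tendsto ht0 (fun n => (hu n).nonneg t ht0) (hB.nonneg t ht0) (hlim t ht0)).const_mul _

include hQ

/-- The upper barrier survives because `Q ξ` equals the bound on the total mass times `ξ`; the lower
one because, with `r = 1`, the source is at least `2 * K 2 * ε` beyond `1`. -/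
lemma IsTrapped.comp_sourceIntegral (hGc : Continuous G)
    (hG : ∀ y, 0 ≤ y → 0 ≤ G y ∧ Q (G y) = y) (hε : 0 ≤ ε) (hQε : Q ε ≤ 2 * K 2 * ε)
    {B : ℝ → ℝ} (hB : IsTrapped ε ξ B) : IsTrapped ε ξ fun x => G (sourceIntegral K ω B x) where
  meas := (hGc.comp (hB.continuous_sourceIntegral hK hω)).measurable
  nonneg x hx := (hG _ (hB.sourceIntegral_nonneg hK hω hx)).1
  le x hx := by
    obtain ⟨h0, h1⟩ := hG _ (hB.sourceIntegral_nonneg hK hω hx)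
    rw [← hQ.le_iff h0 hQ.xi_pos.le, h1, hQ.apply_xi, mul_comm]
    exact (integral_source_le hK hω hx (hB.integrableOn hK hω x)
      fun t ht => ⟨hB.nonneg t ht, hB.le t ht⟩).trans
      (mul_le_mul_of_nonneg_left (integral_mul_one_add_lt hK hω x).le hQ.xi_pos.le)
  ge x hx := by
    have hx0 : 0 ≤ x := zero_le_one.trans hx.le
    obtain ⟨h0, h1⟩ := hG _ (hB.sourceIntegral_nonneg hK hω hx0)
    rw [← hQ.le_iff hε h0, h1]
    have := le_integral_source hK hω hx0 zero_le_one hε (hB.integrableOn hK hω x) hB.nonneg hB.ge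
    rw [min_eq_right hx.le, mul_one, mul_one, mul_comm] at this
    exact hQε.trans this

/-- The decreasing iteration started at the constant `ξ` converges to a continuous solution. -/
lemma exists_continuous_solution :
    ∃ B, InClassM B ∧ IsSolution K ω Q B ∧ ContinuousOn B (Ici 0) := by
  obtain ⟨G, hGc, hGm, hG, hGQ⟩ :=
    exists_continuous_monotone_inverse hQ.zero hQ.cont hQ.mono hQ.convex hQ.xi_pos
  obtain ⟨ε, hε, hεξ, hQε⟩ := hQ.exists_apply_le_mul (mul_pos two_pos (hK.pos 2))
  let T : (ℝ → ℝ) → ℝ → ℝ := fun B x => G (sourceIntegral K ω B x)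
  have hT : ∀ B, IsTrapped ε ξ B → IsTrapped ε ξ (T B) := fun B hB =>
    hB.comp_sourceIntegral hK hω hQ hGc hG hε.le hQε
  let u : ℕ → ℝ → ℝ := fun n => T^[n] fun _ => ξ
  have hsucc : ∀ n, u (n + 1) = T (u n) := fun n => Function.iterate_succ_apply' _ _ _
  have hu : ∀ n, IsTrapped ε ξ (u n) := by
    intro n
    induction n with
    | zero => exact ⟨measurable_const, fun _ _ => hQ.xi_pos.le, fun _ _ => le_rfl,
        fun _ _ => hεξ.le⟩
    | succ n ih => rw [hsucc]; exact hT _ ih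
  have hstep : ∀ n t, 0 ≤ t → u (n + 1) t ≤ u n t := by
    intro n
    induction n with
    | zero => exact fun t ht => (hu 1).le t ht
    | succ n ih =>
      intro t ht
      rw [hsucc (n + 1), hsucc n]
      have := (hu (n + 1)).sourceIntegral_mono hK hω (hu n) ih ht
      rw [hsucc n] at this
      exact hGm this
  let B : ℝ → ℝ := fun t => ⨅ n, u n t
  have hbdd : ∀ t, 0 ≤ t → BddBelow (range fun n => u n t) := fun t ht =>
    ⟨0, by rintro _ ⟨n, rfl⟩; exact (hu n).nonneg t ht⟩
  have hlim : ∀ t, 0 ≤ t → Tendsto (fun n => u n t) atTop (𝓝 (B t)) := fun t ht =>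
    tendsto_atTop_ciInf (antitone_nat_of_succ_le fun n => hstep n t ht) (hbdd t ht)
  have hB : IsTrapped ε ξ B :=
    { meas := Measurable.iInf fun n => (hu n).meas
      nonneg := fun t ht => le_ciInf fun n => (hu n).nonneg t ht
      le := fun t ht => (ciInf_le (hbdd t ht) 0).trans ((hu 0).le t ht)
      ge := fun t ht => le_ciInf fun n => (hu n).ge t ht }
  -- The shifted iterates tend both to `B x` and, by dominated convergence, to the image of `B`.
  have hfix : ∀ x, 0 ≤ x → B x = G (sourceIntegral K ω B x) := fun x hx => by
    have h1 := (hlim x hx).comp (tendsto_add_atTop_nat 1)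
    have h2 := (hGc.tendsto _).comp (IsTrapped.tendsto_sourceIntegral hK hω hu hB hlim x)
    refine tendsto_nhds_unique h1 (h2.congr fun n => ?_)
    simp only [Function.comp_apply, hsucc, T]
  refine ⟨B, ⟨⟨ξ, fun x hx => ?_⟩, hB.nonneg, 1, one_pos, ?_⟩, fun x hx => ⟨?_, ?_⟩, ?_⟩
  · rw [abs_of_nonneg (hB.nonneg x hx)]
    exact hB.le x hx
  · refine hε.trans_le (le_csInf (nonempty_Ioi.image B) ?_)
    rintro _ ⟨t, ht, rfl⟩
    exact hB.ge t ht
  · exact hB.integrableOn hK hω x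
  · rw [hfix x hx]
    exact (hG _ (hB.sourceIntegral_nonneg hK hω hx)).2
  · exact (hGc.comp (hB.continuous_sourceIntegral hK hω)).continuousOn.congr hfix

end Existence

theorem theorem3
    (K : ℝ → ℝ) (ω₂ : ℝ → ℝ → ℝ) (μ₂ Q φ : ℝ → ℝ) (ξ : ℝ)
    -- the kernel: positive, even, `C¹`, bounded together with its derivative
    (hK_pos : ∀ x, 0 < K x)
    (hK_even : ∀ x, K (-x) = K x)
    (hK_C1 : ContDiff ℝ 1 K)
    (hK_bdd : ∃ C : ℝ, ∀ x, |K x| ≤ C)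
    (hK_deriv_bdd : ∃ C : ℝ, ∀ x, |deriv K x| ≤ C)
    -- decreasing on the half-line, with integral `1/2` and finite first moment
    (hK_anti : AntitoneOn K (Ici 0))
    (hK_int : IntegrableOn K (Ioi 0))
    (hK_half : ∫ t in Ioi (0 : ℝ), K t = 1 / 2)
    (hK_moment : IntegrableOn (fun x => x * K x) (Ioi 0))
    -- criticality
    (hQ_zero : Q 0 = 0)
    (hω_zero : ∀ t, 0 ≤ t → ω₂ t 0 = 0)
    -- the perturbation `ω₂`
    (hω_cont : ContinuousOn (fun p : ℝ × ℝ => ω₂ p.1 p.2) (Ici 0 ×ˢ Ici 0))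
    (hω_mono : ∀ t, 0 ≤ t → MonotoneOn (ω₂ t) (Ici 0))
    (hω_concave : ∀ t, 0 ≤ t → ConcaveOn ℝ (Ici 0) (ω₂ t))
    (hμ_pos : ∀ t, 0 ≤ t → 0 < μ₂ t)
    (hμ_int : IntegrableOn μ₂ (Ioi 0))
    (hμ_lim : Tendsto μ₂ atTop (𝓝 0))
    (hω_le : ∀ t u, 0 ≤ t → 0 ≤ u → ω₂ t u ≤ μ₂ t * u)
    -- the nonlinearity `Q`
    (hQ_cont : ContinuousOn Q (Ici 0))
    (hQ_mono : StrictMonoOn Q (Ici 0))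
    (hQ_convex : ConvexOn ℝ (Ici 0) Q)
    (hξ_pos : 0 < ξ)
    (hQ_ξ : Q ξ = (1 + constM K μ₂) * ξ)
    -- the function `φ`
    (hφ_maps : MapsTo φ (Icc 0 1) (Icc 0 1))
    (hφ_cont : ContinuousOn φ (Icc 0 1))
    (hφ_mono : MonotoneOn φ (Icc 0 1))
    (hφ_concave : ConcaveOn ℝ (Icc 0 1) φ)
    (hφ_zero : φ 0 = 0)
    (hφ_one : φ 1 = 1)
    (hφ_ne_id : ∃ σ ∈ Ioo (0 : ℝ) 1, φ σ ≠ σ)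
    (hφ_G : ∀ σ ∈ Ioo (0 : ℝ) 1, ∀ u ∈ Ioo (0 : ℝ) ((1 + constM K μ₂) * ξ),
      φ σ * halfLineInverse Q u ≤ halfLineInverse Q (σ * u)) :
    ∃ B : ℝ → ℝ, InClassM B ∧ IsSolution K ω₂ Q B ∧ ContinuousOn B (Ici 0) ∧
      ∀ B' : ℝ → ℝ, InClassM B' → IsSolution K ω₂ Q B' → EqOn B' B (Ici 0) := by
  obtain ⟨L, hL⟩ := hK_deriv_bdd
  have hK : EvenDecreasingKernel K L :=
    { pos := hK_pos
      even := hK_even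
      cont := hK_C1.continuous
      anti := hK_anti
      integrableOn := hK_int
      half := hK_half
      -- The mean value inequality turns the derivative bound into a Lipschitz constant.
      lip := fun x y => convex_univ.norm_image_sub_le_of_norm_deriv_le
        (fun z _ => (hK_C1.differentiable one_ne_zero) z) (fun z _ => hL z)
        (mem_univ y) (mem_univ x) }
  have hω : ConcavePerturbation ω₂ μ₂ :=
    ⟨hω_cont, hω_mono, hω_concave, hω_zero, hω_le, hμ_int, hμ_pos⟩
  have hM : 0 ≤ constM K μ₂ := by
    rw [constM, hK.iSup_eq]
    exact mul_nonneg hω.integral_nonneg (hK.pos 0).le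
  have hQ : SublinearInverse Q φ (1 + constM K μ₂) ξ :=
    { zero := hQ_zero
      cont := hQ_cont
      mono := hQ_mono
      convex := hQ_convex
      xi_pos := hξ_pos
      coeff_pos := by linarith
      apply_xi := hQ_ξ
      maps := hφ_maps
      lt := fun σ hσ => hφ_concave.lt_of_ne_id hφ_zero hφ_one hφ_ne_id hσ
      scale := fun σ hσ v hv hvξ => scale_of_halfLineInverse hQ_zero hQ_cont hQ_mono hQ_convex
        hξ_pos hφ_maps (by rwa [hQ_ξ]) hσ hv hvξ }
  obtain ⟨B, hB, hs, hc⟩ := exists_continuous_solution hK hω hQ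
  exact ⟨B, hB, hs, hc, fun B' hB' hs' x hx =>
    le_antisymm (hs'.le hK hω hQ hB' hB hs hx) (hs.le hK hω hQ hB hB' hs' hx)⟩
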